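/- Let $\mathbb K=\mathbb R$ or $\mathbb C$ (all variables, constants and functions are $\mathbb K$-valued, and all derivatives are taken over $\mathbb K$). Let $\sigma>0$ be real and consider the two-component Hunter–Saxton (2-HS) equation with $\kappa=2$, $$m_t+u\,m_x+2m\,u_x-\sigma\rho\rho_x=0,\qquad m=2-u_{xx},\qquad \rho_t+(\rho u)_x=0 .$$ Let $N$ be a natural number, and for $1\le i\le N$ let $a_{i,1},a_{i,2},\xi_{i0},\eta_{i0}\in\mathbb K$ be arbitrary constants and $p_i\in\mathbb K$ with $p_i\neq0$ and $p_i^{-1}\neq\pm\sqrt\sigma/2$. For $n\in\mathbb Z$ put $$\tau_n(y,s)=\det\bigl(\psi_i^{(n+j-1)}(y,s)\bigr)_{1\le i,j\le N},\qquad \psi_i^{(n)}=a_{i,1}\Bigl(p_i^{-1}-\tfrac{\sqrt\sigma}{2}\Bigr)^n e^{\xi_i}+a_{i,2}\Bigl(-p_i^{-1}-\tfrac{\sqrt\sigma}{2}\Bigr)^n e^{\eta_i},$$ $$\xi_i=\frac{1}{p_i^{-1}-\sqrt\sigma/2}\,y+p_i^{-1}s+\xi_{i0},\qquad \eta_i=-\frac{1}{p_i^{-1}+\sqrt\sigma/2}\,y-p_i^{-1}s+\eta_{i0},$$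 and let $g=\tau_0$, $f=\tau_1$, $h=\tau_{-1}$. Then $$u=-(\ln g)_{ss},\qquad \rho=\frac{g^2}{fh},\qquad x=y-(\ln g)_s,\qquad t=s$$ (where $(\ln g)_s=g_s/g$) is a solution of the 2-HS equation in parametric form, called the $N$-soliton solution, on the open set $P=\{(y,s): f\neq0,\ g\neq0,\ h\neq0\}$. That is: the map $\Phi:(y,s)\mapsto(x,t)$ is a local $C^\infty$-diffeomorphism on $P$ (each point of $P$ has an open neighbourhood in $P$ that $\Phi$ maps diffeomorphically onto an open set); and for every open $W\subseteq P$ on which $u$ and $\rho$ can be written as functions of $(x,t)=\Phi(y,s)$ (for instance every open $W\subseteq P$ on which $\Phi$ is injective), these functions are $C^\infty$ and satisfy the 2-HS equation on the open set $\Phi(W)$. -/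

import Mathlib

open scoped ContDiff

namespace TwoHS

noncomputable section

variable {𝕜 : Type*} [RCLike 𝕜]

/-- Partial derivative in the first variable. -/
def D₁ (F : 𝕜 → 𝕜 → 𝕜) (a b : 𝕜) : 𝕜 := deriv (fun a' => F a' b) a

/-- Partial derivative in the second variable. -/
def D₂ (F : 𝕜 → 𝕜 → 𝕜) (a b : 𝕜) : 𝕜 := deriv (fun b' => F a b') b

/-- `m = κ - u_xx`. -/
def momentum (κ : 𝕜) (u : 𝕜 → 𝕜 → 𝕜) (x t : 𝕜) : 𝕜 := κ - D₁ (D₁ u) x t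

/-- `(u, ρ)`, as functions of `(x, t)`, is a smooth classical solution on the open set `Ω` of the
two-component Hunter-Saxton equation
`m_t + u m_x + 2 m u_x - σ ρ ρ_x = 0`, `m = κ - u_xx`, `ρ_t + (ρ u)_x = 0`. -/
structure IsSolutionOn (κ σ : 𝕜) (Ω : Set (𝕜 × 𝕜)) (u ρ : 𝕜 → 𝕜 → 𝕜) : Prop where
  isOpen : IsOpen Ω
  smooth_u : ContDiffOn 𝕜 ∞ (fun z : 𝕜 × 𝕜 => u z.1 z.2) Ω
  smooth_ρ : ContDiffOn 𝕜 ∞ (fun z : 𝕜 × 𝕜 => ρ z.1 z.2) Ω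
  momentum_eq : ∀ x t : 𝕜, (x, t) ∈ Ω →
    D₂ (momentum κ u) x t + u x t * D₁ (momentum κ u) x t
      + 2 * momentum κ u x t * D₁ u x t - σ * ρ x t * D₁ ρ x t = 0
  continuity_eq : ∀ x t : 𝕜, (x, t) ∈ Ω →
    D₂ ρ x t + D₁ (fun x' t' => ρ x' t' * u x' t') x t = 0

/-- The functions `X, T, U, R` of the parameters `(y, s) ∈ P` are a parametric solution
`x = X (y, s)`, `t = T (y, s)`, `u = U (y, s)`, `ρ = R (y, s)` of the two-component Hunter-Saxton
equation: `(y, s) ↦ (x, t)` is a local diffeomorphism on the open set `P`, and whenever `U` and `R`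
become functions `v`, `r` of `(x, t)` on some open piece `W` of `P` (in particular whenever
`(y, s) ↦ (x, t)` is injective on `W`), these solve the equation on the image of `W`. -/
structure IsParametricSolutionOn (κ σ : 𝕜) (P : Set (𝕜 × 𝕜)) (X T U R : 𝕜 → 𝕜 → 𝕜) :
    Prop where
  isOpen : IsOpen P
  localDiffeo : ∀ z ∈ P, ∃ e : OpenPartialHomeomorph (𝕜 × 𝕜) (𝕜 × 𝕜),
    z ∈ e.source ∧ e.source ⊆ P ∧ (∀ w ∈ e.source, e w = (X w.1 w.2, T w.1 w.2)) ∧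
      ContDiffOn 𝕜 ∞ e e.source ∧ ContDiffOn 𝕜 ∞ e.symm e.target
  solves : ∀ W : Set (𝕜 × 𝕜), IsOpen W → W ⊆ P → ∀ v r : 𝕜 → 𝕜 → 𝕜,
    (∀ y s : 𝕜, (y, s) ∈ W → v (X y s) (T y s) = U y s ∧ r (X y s) (T y s) = R y s) →
      IsSolutionOn κ σ ((fun w : 𝕜 × 𝕜 => (X w.1 w.2, T w.1 w.2)) '' W) v r

/-- `ξ = y / (p⁻¹ - √σ/2) + p⁻¹ s + ξ₀`. -/
def phaseXi (σ : ℝ) (p ξ₀ y s : 𝕜) : 𝕜 :=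
  1 / (p⁻¹ - ((√σ : ℝ) : 𝕜) / 2) * y + p⁻¹ * s + ξ₀

/-- `η = - y / (p⁻¹ + √σ/2) - p⁻¹ s + η₀`. -/
def phaseEta (σ : ℝ) (p η₀ y s : 𝕜) : 𝕜 :=
  -(1 / (p⁻¹ + ((√σ : ℝ) : 𝕜) / 2)) * y - p⁻¹ * s + η₀

/-- `ψ⁽ⁿ⁾ = a₁ (p⁻¹ - √σ/2)ⁿ e^ξ + a₂ (-p⁻¹ - √σ/2)ⁿ e^η`, for an integer `n`. -/
def psi (σ : ℝ) (p a₁ a₂ ξ₀ η₀ : 𝕜) (n : ℤ) (y s : 𝕜) : 𝕜 :=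
  a₁ * (p⁻¹ - ((√σ : ℝ) : 𝕜) / 2) ^ n * NormedSpace.exp (phaseXi σ p ξ₀ y s)
    + a₂ * (-p⁻¹ - ((√σ : ℝ) : 𝕜) / 2) ^ n * NormedSpace.exp (phaseEta σ p η₀ y s)

/-- The Casorati determinant `τ_n = det (ψ_i^{(n + j)})`, `0 ≤ j ≤ N - 1`. -/
def tau {N : ℕ} (σ : ℝ) (p a₁ a₂ ξ₀ η₀ : Fin N → 𝕜) (n : ℤ) (y s : 𝕜) : 𝕜 :=
  Matrix.det (Matrix.of fun i j : Fin N =>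
    psi σ (p i) (a₁ i) (a₂ i) (ξ₀ i) (η₀ i) (n + (j : ℤ)) y s)

/-- `(ln g)_s = g_s / g` as a function of `(y, s)`; no branch of the logarithm is involved. -/
def lnDerivS (g : 𝕜 → 𝕜 → 𝕜) (y s : 𝕜) : 𝕜 := logDeriv (fun s' => g y s') s

end

end TwoHS

/-! Reciprocal transformation: if `q = X_y` and `U = X_s`, then `∂_s = ∂_t + u ∂_x` and `∂_y = q
∂_x`. With `ρ = 1/q` the continuity equation becomes `X_sy = X_ys`, and `u_x = L := q_s/q`. The
momentum equation becomes `4 q_s = L_ys + L L_y - σ q_y/q³`, the `y`-derivative of a potential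
equation for `U` (`isParametricSolutionOn_of_reciprocal`).

Put `c = √σ/2` and `N = M + 1`. Where `g ≠ 0`, the columns `V_0, …, V_M` of the Casorati matrix form
a basis, and everything is expressed by coordinates in it: `a` and `w` are the coordinates of
`V_{M+1}` along `V_M` and `V_0`, and `z` is that of `V_{-1}` along `V_M`. Cramer's rule gives `f = ±
g w` and `h = ± g z` with the same sign, and `g_s/g = a + N c`. The `y`-flow lowers the index and
yields the Toda equation `a_y = 1 - w z`, so `q = w z = f h/g²`. The `s`-flow raises it; with the
two-term recurrence of `ψ` it yields a Wronskian relation for `w, z` and a Schrödinger-type equation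
for `w`. Together these imply the potential equation (`isParametricSolutionOn_of_bilinear`). -/

open scoped ContDiff

namespace TwoHS

/-! ### Partial derivatives of smooth functions of two variables. -/

section Calculus

variable {𝕜 : Type*} [RCLike 𝕜] {F G : 𝕜 → 𝕜 → 𝕜} {P : Set (𝕜 × 𝕜)} {y s : 𝕜}

/-- Smoothness of a function of two variables on a set of pairs. -/
def SmoothOn (F : 𝕜 → 𝕜 → 𝕜) (P : Set (𝕜 × 𝕜)) : Prop :=
  ContDiffOn 𝕜 ∞ (fun z : 𝕜 × 𝕜 => F z.1 z.2) P

theorem SmoothOn.hasFDerivAt (hF : SmoothOn F P) (hP : IsOpen P) (h : (y, s) ∈ P) :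
    HasFDerivAt (fun z : 𝕜 × 𝕜 => F z.1 z.2)
      (fderiv 𝕜 (fun z : 𝕜 × 𝕜 => F z.1 z.2) (y, s)) (y, s) :=
  ((hF.contDiffAt (hP.mem_nhds h)).differentiableAt (by simp)).hasFDerivAt

theorem SmoothOn.hasDerivAt_fst_fderiv (hF : SmoothOn F P) (hP : IsOpen P) (h : (y, s) ∈ P) :
    HasDerivAt (fun a => F a s) (fderiv 𝕜 (fun z : 𝕜 × 𝕜 => F z.1 z.2) (y, s) (1, 0)) y :=
  HasFDerivAt.comp_hasDerivAt_of_eq (f := fun a => (a, s)) y (hF.hasFDerivAt hP h)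
    ((hasDerivAt_id y).prodMk (hasDerivAt_const y s)) rfl

theorem SmoothOn.hasDerivAt_snd_fderiv (hF : SmoothOn F P) (hP : IsOpen P) (h : (y, s) ∈ P) :
    HasDerivAt (fun b => F y b) (fderiv 𝕜 (fun z : 𝕜 × 𝕜 => F z.1 z.2) (y, s) (0, 1)) s :=
  (hF.hasFDerivAt hP h).comp_hasDerivAt s ((hasDerivAt_const s y).prodMk (hasDerivAt_id s))

theorem SmoothOn.D₁_eq_fderiv (hF : SmoothOn F P) (hP : IsOpen P) (h : (y, s) ∈ P) :
    D₁ F y s = fderiv 𝕜 (fun z : 𝕜 × 𝕜 => F z.1 z.2) (y, s) (1, 0) :=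
  (hF.hasDerivAt_fst_fderiv hP h).deriv

theorem SmoothOn.D₂_eq_fderiv (hF : SmoothOn F P) (hP : IsOpen P) (h : (y, s) ∈ P) :
    D₂ F y s = fderiv 𝕜 (fun z : 𝕜 × 𝕜 => F z.1 z.2) (y, s) (0, 1) :=
  (hF.hasDerivAt_snd_fderiv hP h).deriv

theorem SmoothOn.hasDerivAt_fst (hF : SmoothOn F P) (hP : IsOpen P) (h : (y, s) ∈ P) :
    HasDerivAt (fun a => F a s) (D₁ F y s) y :=
  (hF.hasDerivAt_fst_fderiv hP h).differentiableAt.hasDerivAt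

theorem SmoothOn.hasDerivAt_snd (hF : SmoothOn F P) (hP : IsOpen P) (h : (y, s) ∈ P) :
    HasDerivAt (fun b => F y b) (D₂ F y s) s :=
  (hF.hasDerivAt_snd_fderiv hP h).differentiableAt.hasDerivAt

theorem SmoothOn.D₁ (hF : SmoothOn F P) (hP : IsOpen P) : SmoothOn (D₁ F) P :=
  ((hF.fderiv_of_isOpen hP (m := ∞) (by simp)).clm_apply contDiffOn_const).congr
    fun _ hz => hF.D₁_eq_fderiv hP hz

theorem SmoothOn.D₂ (hF : SmoothOn F P) (hP : IsOpen P) : SmoothOn (D₂ F) P :=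
  ((hF.fderiv_of_isOpen hP (m := ∞) (by simp)).clm_apply contDiffOn_const).congr
    fun _ hz => hF.D₂_eq_fderiv hP hz

theorem eventually_fst_mem (hP : IsOpen P) (h : (y, s) ∈ P) :
    ∀ᶠ a in nhds y, (a, s) ∈ P :=
  (Continuous.prodMk_left s).continuousAt.eventually (hP.mem_nhds h)

theorem eventually_snd_mem (hP : IsOpen P) (h : (y, s) ∈ P) :
    ∀ᶠ b in nhds s, (y, b) ∈ P :=
  (Continuous.prodMk_right y).continuousAt.eventually (hP.mem_nhds h)

theorem D₁_congr (hP : IsOpen P) (hFG : ∀ y s, (y, s) ∈ P → F y s = G y s) (h : (y, s) ∈ P) :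
    D₁ F y s = D₁ G y s :=
  Filter.EventuallyEq.deriv_eq ((eventually_fst_mem hP h).mono fun a ha => hFG a s ha)

theorem D₂_congr (hP : IsOpen P) (hFG : ∀ y s, (y, s) ∈ P → F y s = G y s) (h : (y, s) ∈ P) :
    D₂ F y s = D₂ G y s :=
  Filter.EventuallyEq.deriv_eq ((eventually_snd_mem hP h).mono fun b hb => hFG y b hb)

theorem SmoothOn.D₁_D₂_comm (hF : SmoothOn F P) (hP : IsOpen P) (h : (y, s) ∈ P) :
    TwoHS.D₁ (TwoHS.D₂ F) y s = TwoHS.D₂ (TwoHS.D₁ F) y s := by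
  set Φ := fun z : 𝕜 × 𝕜 => F z.1 z.2 with hΦ
  have hat : ContDiffAt 𝕜 ∞ Φ (y, s) := hF.contDiffAt (hP.mem_nhds h)
  have hsymm : IsSymmSndFDerivAt 𝕜 Φ (y, s) := hat.isSymmSndFDerivAt (by
    rw [minSmoothness_of_isRCLikeNormedField]
    exact WithTop.coe_le_coe.2 le_top)
  have hd : HasFDerivAt (fderiv 𝕜 Φ) (fderiv 𝕜 (fderiv 𝕜 Φ) (y, s)) (y, s) :=
    (((hF.fderiv_of_isOpen hP (m := ∞) (by simp)).contDiffAt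
      (hP.mem_nhds h)).differentiableAt (by simp)).hasFDerivAt
  have e₁ : TwoHS.D₁ (TwoHS.D₂ F) y s = fderiv 𝕜 (fderiv 𝕜 Φ) (y, s) (1, 0) (0, 1) := by
    rw [D₁_congr (G := fun a b => fderiv 𝕜 Φ (a, b) (0, 1)) hP
      (fun a b hab => hF.D₂_eq_fderiv hP hab) h]
    have := hd.comp_hasDerivAt y ((hasDerivAt_id y).prodMk (hasDerivAt_const y s))
    exact (this.clm_apply (hasDerivAt_const y ((0, 1) : 𝕜 × 𝕜))).deriv.trans (by simp)
  have e₂ : TwoHS.D₂ (TwoHS.D₁ F) y s = fderiv 𝕜 (fderiv 𝕜 Φ) (y, s) (0, 1) (1, 0) := by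
    rw [D₂_congr (G := fun a b => fderiv 𝕜 Φ (a, b) (1, 0)) hP
      (fun a b hab => hF.D₁_eq_fderiv hP hab) h]
    have := hd.comp_hasDerivAt s ((hasDerivAt_const s y).prodMk (hasDerivAt_id s))
    exact (this.clm_apply (hasDerivAt_const s ((1, 0) : 𝕜 × 𝕜))).deriv.trans (by simp)
  rw [e₁, e₂]
  exact hsymm _ _

/-- The chain rule along `(y, s) ↦ (X y s, s)`. -/
theorem chain_rule {W Ω : Set (𝕜 × 𝕜)} {X : 𝕜 → 𝕜 → 𝕜} (hW : IsOpen W) (hΩ : IsOpen Ω)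
    (hX : SmoothOn X W) (hF : SmoothOn F Ω) (hmaps : ∀ y s, (y, s) ∈ W → (X y s, s) ∈ Ω)
    (hFG : ∀ y s, (y, s) ∈ W → F (X y s) s = G y s) (h : (y, s) ∈ W) :
    D₁ G y s = D₁ F (X y s) s * D₁ X y s ∧
      D₂ G y s = D₂ F (X y s) s + D₂ X y s * D₁ F (X y s) s := by
  have hΩ' := hmaps y s h
  have hf := hF.hasFDerivAt hΩ hΩ'
  rw [hF.D₁_eq_fderiv hΩ hΩ', hF.D₂_eq_fderiv hΩ hΩ',
    ← D₁_congr hW hFG h, ← D₂_congr hW hFG h]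
  constructor
  · have := hf.comp_hasDerivAt y ((hX.hasDerivAt_fst hW h).prodMk (hasDerivAt_const y s))
    refine this.deriv.trans ?_
    rw [mul_comm, ← smul_eq_mul, ← map_smul]
    simp
  · have := HasFDerivAt.comp_hasDerivAt_of_eq (f := fun b => (X y b, b)) s hf
      ((hX.hasDerivAt_snd hW h).prodMk (hasDerivAt_id s)) rfl
    refine this.deriv.trans ?_
    rw [← smul_eq_mul, ← map_smul, ← map_add]
    simp

end Calculus

/-! ### The reciprocal transformation. -/

section Reciprocal

variable {𝕜 : Type*} [RCLike 𝕜] {F G X U R q : 𝕜 → 𝕜 → 𝕜} {P W : Set (𝕜 × 𝕜)} {y s : 𝕜}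

/-- The linear automorphism `(a, b) ↦ (d a + k b, b)` for `d ≠ 0`. -/
noncomputable def shearEquiv (d k : 𝕜) (hd : d ≠ 0) : (𝕜 × 𝕜) ≃L[𝕜] (𝕜 × 𝕜) :=
  ContinuousLinearEquiv.equivOfInverse
    ((d • ContinuousLinearMap.fst 𝕜 𝕜 𝕜 + k • ContinuousLinearMap.snd 𝕜 𝕜 𝕜).prod
      (ContinuousLinearMap.snd 𝕜 𝕜 𝕜))
    ((d⁻¹ • ContinuousLinearMap.fst 𝕜 𝕜 𝕜 - (d⁻¹ * k) • ContinuousLinearMap.snd 𝕜 𝕜 𝕜).prod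
      (ContinuousLinearMap.snd 𝕜 𝕜 𝕜))
    (fun x => by ext <;> simp; field_simp; ring)
    (fun x => by ext <;> simp; field_simp; ring)

theorem hasFDerivAt_parametrization (hP : IsOpen P) (hX : SmoothOn X P) (h : (y, s) ∈ P)
    (hd : D₁ X y s ≠ 0) :
    HasFDerivAt (fun w : 𝕜 × 𝕜 => (X w.1 w.2, w.2))
      (shearEquiv (D₁ X y s) (D₂ X y s) hd : (𝕜 × 𝕜) →L[𝕜] (𝕜 × 𝕜)) (y, s) := by
  refine ((hX.hasFDerivAt hP h).prodMk hasFDerivAt_snd).congr_fderiv ?_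
  refine ContinuousLinearMap.ext fun x => ?_
  have hx : x = x.1 • ((1 : 𝕜), (0 : 𝕜)) + x.2 • ((0 : 𝕜), (1 : 𝕜)) := by ext <;> simp
  refine Prod.ext ?_ rfl
  change fderiv 𝕜 (fun z : 𝕜 × 𝕜 => X z.1 z.2) (y, s) x = D₁ X y s * x.1 + D₂ X y s * x.2
  rw [hX.D₁_eq_fderiv hP h, hX.D₂_eq_fderiv hP h]
  conv_lhs => rw [hx]
  rw [map_add, map_smul, map_smul, smul_eq_mul, smul_eq_mul]
  ring

theorem SmoothOn.contDiffOn_parametrization (hX : SmoothOn X P) :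
    ContDiffOn 𝕜 ∞ (fun w : 𝕜 × 𝕜 => (X w.1 w.2, w.2)) P :=
  ContDiffOn.prodMk hX contDiffOn_snd

theorem exists_local_diffeo (hP : IsOpen P) (hX : SmoothOn X P)
    (hd : ∀ y s, (y, s) ∈ P → D₁ X y s ≠ 0) (z : 𝕜 × 𝕜) (hz : z ∈ P) :
    ∃ e : OpenPartialHomeomorph (𝕜 × 𝕜) (𝕜 × 𝕜),
      z ∈ e.source ∧ e.source ⊆ P ∧ (∀ w ∈ e.source, e w = (X w.1 w.2, w.2)) ∧
        ContDiffOn 𝕜 ∞ e e.source ∧ ContDiffOn 𝕜 ∞ e.symm e.target := by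
  have hΦ := hX.contDiffOn_parametrization
  have hat := hΦ.contDiffAt (hP.mem_nhds hz)
  have hfd := hasFDerivAt_parametrization hP hX hz (hd _ _ hz)
  -- Inside `P` the derivative is invertible at every point of the source, so the inverse is smooth
  -- on the whole target and not only at the image of `z`.
  let e := (hat.toOpenPartialHomeomorph _ hfd (by simp)).restrOpen P hP
  have hsub : e.source ⊆ P := fun w hw => hw.2
  refine ⟨e, ⟨hat.mem_toOpenPartialHomeomorph_source hfd (by simp), hz⟩, hsub,
    fun w _ => rfl, hΦ.mono hsub, fun x hx => ?_⟩
  have hmem := hsub (e.map_target hx)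
  exact (e.contDiffAt_symm hx (hasFDerivAt_parametrization hP hX hmem (hd _ _ hmem))
    (hΦ.contDiffAt (hP.mem_nhds hmem))).contDiffWithinAt

theorem isOpen_image_parametrization (hW : IsOpen W) (hX : SmoothOn X W)
    (hd : ∀ y s, (y, s) ∈ W → D₁ X y s ≠ 0) :
    IsOpen ((fun w : 𝕜 × 𝕜 => (X w.1 w.2, w.2)) '' W) := by
  rw [isOpen_iff_mem_nhds]
  rintro _ ⟨z, hz, rfl⟩
  obtain ⟨e, hze, hsub, he, -, -⟩ := exists_local_diffeo hW hX hd z hz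
  have hopen := e.isOpen_image_of_subset_source e.open_source subset_rfl
  refine Filter.mem_of_superset (hopen.mem_nhds ⟨z, hze, he z hze⟩) ?_
  rintro _ ⟨w, hw, rfl⟩
  exact ⟨w, hsub hw, (he w hw).symm⟩

/-- A function that becomes smooth in the parameters is smooth. -/
theorem smoothOn_image_parametrization (hW : IsOpen W) (hX : SmoothOn X W)
    (hd : ∀ y s, (y, s) ∈ W → D₁ X y s ≠ 0) (hG : SmoothOn G W)
    (hFG : ∀ y s, (y, s) ∈ W → F (X y s) s = G y s) :
    SmoothOn F ((fun w : 𝕜 × 𝕜 => (X w.1 w.2, w.2)) '' W) := by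
  rintro _ ⟨z, hz, rfl⟩
  obtain ⟨e, hze, hsub, he, -, hsymm⟩ := exists_local_diffeo hW hX hd z hz
  have htarget : (X z.1 z.2, z.2) ∈ e.target := he z hze ▸ e.map_source hze
  have hcomp : ContDiffOn 𝕜 ∞ ((fun w : 𝕜 × 𝕜 => G w.1 w.2) ∘ e.symm) e.target :=
    ContDiffOn.comp hG hsymm fun x hx => hsub (e.map_target hx)
  refine ((hcomp.contDiffAt (e.open_target.mem_nhds htarget)).congr_of_eventuallyEq
    ?_).contDiffWithinAt
  filter_upwards [e.open_target.mem_nhds htarget] with x hx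
  have hmem := e.map_target hx
  have hx' : (X (e.symm x).1 (e.symm x).2, (e.symm x).2) = x :=
    (he _ hmem).symm.trans (e.right_inv hx)
  have h₁ : X (e.symm x).1 (e.symm x).2 = x.1 := (Prod.ext_iff.1 hx').1
  have h₂ : (e.symm x).2 = x.2 := (Prod.ext_iff.1 hx').2
  have h₃ : F (X (e.symm x).1 (e.symm x).2) (e.symm x).2 = G (e.symm x).1 (e.symm x).2 :=
    hFG _ _ (hsub hmem)
  rw [h₁] at h₃
  exact (congrArg (F x.1) h₂.symm).trans h₃

/-- The reciprocal transformation: functions `X`, `U = X_s`, `R = 1 / X_y` of the parameters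
`(y, s)` give a parametric solution of the two-component Hunter-Saxton equation as soon as
`4 U = L_s + L² / 2 + σ / 2 (R² - 1)` for `L = (ln X_y)_s`. -/
theorem isParametricSolutionOn_of_reciprocal {σ : 𝕜} (hP : IsOpen P) (hX : SmoothOn X P)
    (hq : ∀ y s, (y, s) ∈ P → D₁ X y s = q y s) (hq0 : ∀ y s, (y, s) ∈ P → q y s ≠ 0)
    (hqs : SmoothOn q P)
    (hU : ∀ y s, (y, s) ∈ P → U y s = D₂ X y s) (hR : ∀ y s, (y, s) ∈ P → R y s = (q y s)⁻¹)
    (hpot : ∀ y s, (y, s) ∈ P → 4 * U y s = D₂ (fun y s => D₂ q y s / q y s) y s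
      + (D₂ q y s / q y s) ^ 2 / 2 + σ / 2 * ((q y s)⁻¹ ^ 2 - 1)) :
    IsParametricSolutionOn (2 : 𝕜) σ P X (fun _ s => s) U R := by
  have hd : ∀ y s, (y, s) ∈ P → D₁ X y s ≠ 0 := fun y s h => hq y s h ▸ hq0 y s h
  have hUs : SmoothOn U P := (hX.D₂ hP).congr fun z hz => hU _ _ hz
  have hRs : SmoothOn R P := (ContDiffOn.inv hqs fun z hz => hq0 _ _ hz).congr
    fun z hz => hR _ _ hz
  set L : 𝕜 → 𝕜 → 𝕜 := fun y s => D₂ q y s / q y s with hL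
  have hLs : SmoothOn L P := ContDiffOn.div (hqs.D₂ hP) hqs fun z hz => hq0 _ _ hz
  -- Equality of mixed partials: `U_y = X_sy = (X_y)_s = q_s`.
  have hUy : ∀ y s, (y, s) ∈ P → D₁ U y s = D₂ q y s := fun y s h => by
    rw [D₁_congr hP hU h, hX.D₁_D₂_comm hP h, D₂_congr hP hq h]
  -- the `y`-derivative of the potential equation
  have hkey : ∀ y s, (y, s) ∈ P → 4 * D₂ q y s = D₂ (D₁ L) y s + L y s * D₁ L y s
      - σ * D₁ q y s / q y s ^ 3 := fun y s h => by
    have h0 := hq0 y s h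
    have hl : HasDerivAt (fun a => 4 * U a s) (4 * D₁ U y s) y :=
      (hUs.hasDerivAt_fst hP h).const_mul 4
    have hr := ((((hLs.D₂ hP).hasDerivAt_fst hP h).add
      (((hLs.hasDerivAt_fst hP h).pow 2).div_const 2)).add
      (((((hqs.hasDerivAt_fst hP h).inv h0).pow 2).sub_const 1).const_mul (σ / 2)))
    have := (hl.congr_of_eventuallyEq
      ((eventually_fst_mem hP h).mono fun a ha => (hpot a s ha).symm)).unique hr
    rw [hUy y s h, hLs.D₁_D₂_comm hP h] at this
    rw [this]
    simp only [Pi.inv_apply, Nat.cast_ofNat, Nat.add_one_sub_one, pow_one]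
    field_simp
    ring
  refine ⟨hP, exists_local_diffeo hP hX hd, fun W hW hWP v r hvr => ?_⟩
  have hXW : SmoothOn X W := hX.mono hWP
  have hdW : ∀ y s, (y, s) ∈ W → D₁ X y s ≠ 0 := fun y s h => hd y s (hWP h)
  set Ω := (fun w : 𝕜 × 𝕜 => (X w.1 w.2, w.2)) '' W with hΩdef
  have hΩ : IsOpen Ω := isOpen_image_parametrization hW hXW hdW
  have hvs : SmoothOn v Ω :=
    smoothOn_image_parametrization hW hXW hdW (hUs.mono hWP) fun y s h => (hvr y s h).1
  have hrs : SmoothOn r Ω :=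
    smoothOn_image_parametrization hW hXW hdW (hRs.mono hWP) fun y s h => (hvr y s h).2
  have hmaps : ∀ y s, (y, s) ∈ W → (X y s, s) ∈ Ω := fun y s h => ⟨(y, s), h, rfl⟩
  have hvx : ∀ y s, (y, s) ∈ W → D₁ v (X y s) s = L y s := fun y s h => by
    have := (chain_rule hW hΩ hXW hvs hmaps (fun y s h => (hvr y s h).1) h).1
    rw [hUy y s (hWP h), hq y s (hWP h)] at this
    exact (eq_div_iff (hq0 y s (hWP h))).2 this.symm
  have hvxx : ∀ y s, (y, s) ∈ W → D₁ (D₁ v) (X y s) s = D₁ L y s / q y s := fun y s h => by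
    have := (chain_rule hW hΩ hXW (hvs.D₁ hΩ) hmaps hvx h).1
    rw [hq y s (hWP h)] at this
    exact (eq_div_iff (hq0 y s (hWP h))).2 this.symm
  have hms : SmoothOn (momentum 2 v) Ω := ContDiffOn.sub contDiffOn_const ((hvs.D₁ hΩ).D₁ hΩ)
  have hm : ∀ y s, (y, s) ∈ W → momentum 2 v (X y s) s = 2 - D₁ L y s / q y s :=
    fun y s h => by rw [momentum, hvxx y s h]
  refine ⟨hΩ, hvs, hrs, ?_, ?_⟩
  · rintro x t ⟨⟨y, s⟩, h, hxt⟩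
    obtain ⟨rfl, rfl⟩ : X y s = x ∧ s = t := Prod.ext_iff.1 hxt
    have hPz := hWP h
    have h0 := hq0 y s hPz
    -- Since `X_s = U`, this is the material derivative `m_t + u m_x`.
    have em := (chain_rule hW hΩ hXW hms hmaps hm h).2
    have er := (chain_rule hW hΩ hXW hrs hmaps (fun y s h => (hvr y s h).2) h).1
    have dm : D₂ (fun y s => 2 - D₁ L y s / q y s) y s = _ :=
      ((((hLs.D₁ hP).hasDerivAt_snd hP hPz).div (hqs.hasDerivAt_snd hP hPz) h0).const_sub 2).deriv
    have dr : D₁ R y s = - D₁ q y s / q y s ^ 2 :=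
      (D₁_congr hP hR hPz).trans ((hqs.hasDerivAt_fst hP hPz).inv h0).deriv
    rw [hq y s hPz, dr] at er
    have er' : D₁ r (X y s) s = - D₁ q y s / q y s ^ 3 := by
      rw [eq_div_iff (pow_ne_zero 3 h0)]
      field_simp at er
      linear_combination -er
    rw [dm, ← hU y s hPz] at em
    rw [(hvr y s h).1, (hvr y s h).2, hR y s hPz, er', ← em, hm y s h, hvx y s h]
    have hk := hkey y s hPz
    have hLq : D₂ q y s = L y s * q y s := (div_mul_cancel₀ _ h0).symm
    rw [hLq] at hk ⊢
    field_simp at hk ⊢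
    linear_combination hk
  · rintro x t ⟨⟨y, s⟩, h, hxt⟩
    obtain ⟨rfl, rfl⟩ : X y s = x ∧ s = t := Prod.ext_iff.1 hxt
    have hPz := hWP h
    have h0 := hq0 y s hPz
    have er := (chain_rule hW hΩ hXW hrs hmaps (fun y s h => (hvr y s h).2) h).2
    have dr : D₂ R y s = - D₂ q y s / q y s ^ 2 :=
      (D₂_congr hP hR hPz).trans ((hqs.hasDerivAt_snd hP hPz).inv h0).deriv
    have dprod : D₁ (fun x' t' => r x' t' * v x' t') (X y s) s = _ :=
      ((hrs.hasDerivAt_fst hΩ (hmaps y s h)).mul (hvs.hasDerivAt_fst hΩ (hmaps y s h))).deriv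
    rw [dr, ← hU y s hPz] at er
    rw [dprod, hvx y s h, (hvr y s h).1, (hvr y s h).2, hR y s hPz]
    have hLq : L y s = D₂ q y s / q y s := rfl
    rw [hLq]
    field_simp at er ⊢
    linear_combination -er

/-- The reciprocal transformation for `X = y - a - k` with `X_y = w z`. -/
theorem isParametricSolutionOn_of_bilinear {σ c k : 𝕜} {a w z : 𝕜 → 𝕜 → 𝕜} (hσ : σ = 4 * c ^ 2)
    (hP : IsOpen P) (ha : SmoothOn a P) (hw : SmoothOn w P) (hz : SmoothOn z P)
    (hw0 : ∀ y s, (y, s) ∈ P → w y s ≠ 0) (hz0 : ∀ y s, (y, s) ∈ P → z y s ≠ 0)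
    (hX : ∀ y s, (y, s) ∈ P → X y s = y - (a y s + k))
    (hU : ∀ y s, (y, s) ∈ P → U y s = -D₂ a y s)
    (hR : ∀ y s, (y, s) ∈ P → R y s = (w y s * z y s)⁻¹)
    (toda : ∀ y s, (y, s) ∈ P → D₁ a y s = 1 - w y s * z y s)
    (wronskian : ∀ y s, (y, s) ∈ P →
      D₂ w y s * z y s - D₂ z y s * w y s + 2 * c * (w y s * z y s) = 2 * c)
    (schrodinger : ∀ y s, (y, s) ∈ P →
      D₂ (D₂ w) y s + 2 * c * D₂ w y s + 2 * D₂ a y s * w y s = 0) :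
    IsParametricSolutionOn (2 : 𝕜) σ P X (fun _ s => s) U R := by
  have hXs : SmoothOn X P :=
    ((contDiffOn_fst.sub (ContDiffOn.add ha contDiffOn_const)).congr fun _ hz => hX _ _ hz)
  have hqs : SmoothOn (fun y s => w y s * z y s) P := ContDiffOn.mul hw hz
  refine isParametricSolutionOn_of_reciprocal (q := fun y s => w y s * z y s) hP hXs ?_
    (fun y s h => mul_ne_zero (hw0 y s h) (hz0 y s h)) hqs ?_ hR ?_
  · intro y s h
    rw [D₁_congr hP hX h]
    refine ((hasDerivAt_id y).sub ((ha.hasDerivAt_fst hP h).add_const k)).deriv.trans ?_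
    rw [toda y s h]
    ring
  · intro y s h
    rw [hU y s h, D₂_congr hP hX h]
    exact (((ha.hasDerivAt_snd hP h).add_const k).const_sub y).deriv.symm
  · intro y s h
    have dq : ∀ y s, (y, s) ∈ P →
        D₂ (fun y s => w y s * z y s) y s = D₂ w y s * z y s + w y s * D₂ z y s :=
      fun y s h => ((hw.hasDerivAt_snd hP h).mul (hz.hasDerivAt_snd hP h)).deriv
    -- The Wronskian relation divided by `w z` eliminates `z_s/z` from `L = w_s/w + z_s/z`.
    have hlog : ∀ y s, (y, s) ∈ P →
        D₂ (fun y s => w y s * z y s) y s / (w y s * z y s)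
          = 2 * (D₂ w y s / w y s) + 2 * c - 2 * c * (w y s * z y s)⁻¹ := fun y s h => by
      have := hw0 y s h
      have := hz0 y s h
      rw [dq y s h]
      field_simp
      linear_combination -wronskian y s h
    have hw' := hw0 y s h
    have hz' := hz0 y s h
    have hL : D₂ (fun y s => D₂ (fun y s => w y s * z y s) y s / (w y s * z y s)) y s = _ :=
      (D₂_congr hP hlog h).trans
        ((((((hw.D₂ hP).hasDerivAt_snd hP h).div (hw.hasDerivAt_snd hP h) hw').const_mul
          2).add_const (2 * c)).sub (((hqs.hasDerivAt_snd hP h).inv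
            (mul_ne_zero hw' hz')).const_mul (2 * c))).deriv
    rw [hL, hlog y s h, hU y s h, dq y s h, hσ]
    have e₁ : D₂ (D₂ w) y s = -(2 * c * D₂ w y s + 2 * D₂ a y s * w y s) := by
      linear_combination schrodinger y s h
    have e₂ : D₂ z y s = (D₂ w y s * z y s + 2 * c * (w y s * z y s) - 2 * c) / w y s := by
      rw [eq_div_iff hw']
      linear_combination -wronskian y s h
    rw [e₁, e₂]
    field_simp
    ring

end Reciprocal

/-! ### Coordinates in the basis of Casorati columns. -/

section Casorati

open Matrix

variable {K : Type*} {N M : ℕ}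

/-- The matrix with columns `V 0, …, V (N - 1)`. -/
def casorati (V : ℤ → Fin N → K) : Matrix (Fin N) (Fin N) K := Matrix.of fun i j => V j i

theorem updateCol_casorati_apply (V : ℤ → Fin N → K) (n : ℤ) (k i j : Fin N) :
    (casorati V).updateCol k (V n) i j = if j = k then V n i else V j i := by
  rw [Matrix.updateCol_apply]
  rfl

variable [Field K]

/-- The coordinates of `V n` in the basis `V 0, …, V (N - 1)`. -/
noncomputable def coord (V : ℤ → Fin N → K) (n : ℤ) : Fin N → K := (casorati V)⁻¹ *ᵥ V n

theorem casorati_mulVec (V : ℤ → Fin N → K) (x : Fin N → K) :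
    casorati V *ᵥ x = ∑ j, x j • V j := by
  ext i
  simp [Matrix.mulVec, dotProduct, casorati, mul_comm]

theorem coord_eq_div (V : ℤ → Fin N → K) (n : ℤ) (k : Fin N) :
    coord V n k = ((casorati V).updateCol k (V n)).det / (casorati V).det := by
  rw [coord, Matrix.inv_def, Matrix.smul_mulVec, ← Matrix.cramer_eq_adjugate_mulVec,
    Pi.smul_apply, Matrix.cramer_apply, Ring.inverse_eq_inv', smul_eq_mul, div_eq_inv_mul]

section

variable {V : ℤ → Fin N → K}

theorem sum_coord_smul (hV : (casorati V).det ≠ 0) (n : ℤ) : ∑ j, coord V n j • V j = V n := by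
  rw [← casorati_mulVec, coord, Matrix.mulVec_mulVec, Matrix.mul_nonsing_inv _ hV.isUnit,
    Matrix.one_mulVec]

theorem inv_casorati_mulVec_sum (hV : (casorati V).det ≠ 0) (x : Fin N → K) :
    (casorati V)⁻¹ *ᵥ (∑ j, x j • V j) = x := by
  rw [← casorati_mulVec, Matrix.mulVec_mulVec, Matrix.nonsing_inv_mul _ hV.isUnit,
    Matrix.one_mulVec]

/-- `V k` is itself a basis vector for `0 ≤ k < N`. Hence an index shift in a sum over the basis
leaves only boundary terms; the `sum_coord_shift` lemmas record them. -/
theorem coord_natCast (hV : (casorati V).det ≠ 0) {k : ℕ} (hk : k < N) (j : Fin N) :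
    coord V k j = if (j : ℕ) = k then 1 else 0 := by
  have h := inv_casorati_mulVec_sum hV (Pi.single ⟨k, hk⟩ 1)
  have h' : ∑ j, (Pi.single (⟨k, hk⟩ : Fin N) (1 : K) : Fin N → K) j • V j = V k := by
    rw [Finset.sum_eq_single ⟨k, hk⟩] <;> simp +contextual
  rw [h'] at h
  rw [coord, h, Pi.single_apply]
  simp [Fin.ext_iff]

theorem cramer_casorati (hV : (casorati V).det ≠ 0) (n : ℤ) (j : Fin N) :
    ((casorati V).updateCol j (V n)).det = (casorati V).det * coord V n j := by
  have := congrFun (Matrix.det_smul_inv_mulVec_eq_cramer (casorati V) (V n) hV.isUnit) j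
  rw [Matrix.cramer_apply] at this
  rw [← this]
  rfl

/-- A linear recurrence with diagonal coefficients, in coordinates. -/
theorem coord_recurrence (hV : (casorati V).det ≠ 0) {c : K} {κ : Fin N → K}
    (hrec : ∀ n i, V (n + 2) i + 2 * c * V (n + 1) i = κ i * V n i) (n : ℤ) (k : Fin N) :
    coord V (n + 2) k + 2 * c * coord V (n + 1) k
      = ∑ j : Fin N, coord V n j * (coord V (j + 2) k + 2 * c * coord V (j + 1) k) := by
  have h : V (n + 2) + (2 * c) • V (n + 1)
      = ∑ j : Fin N, coord V n j • (V (j + 2) + (2 * c) • V (j + 1)) := by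
    ext i
    have hi := congrFun (sum_coord_smul hV n) i
    simp only [Finset.sum_apply, Pi.smul_apply, Pi.add_apply, smul_eq_mul] at hi ⊢
    -- The diagonal matrix with entries `κ i` is linear, so it can be applied to the expansion of `V
    -- n` term by term.
    simp_rw [hrec, ← hi, Finset.mul_sum]
    exact Finset.sum_congr rfl fun j _ => by ring
  have := congrFun (congrArg ((casorati V)⁻¹ *ᵥ ·) h) k
  simpa only [Matrix.mulVec_add, Matrix.mulVec_smul, Matrix.mulVec_sum, Finset.sum_apply,
    Pi.add_apply, Pi.smul_apply, smul_eq_mul] using! this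

end

/-- The last but one entry of a vector, zero if there is none. -/
def penultimate (x : Fin (M + 1) → K) : K :=
  ∑ j : Fin (M + 1), if (j : ℕ) + 1 = M then x j else 0

section

variable {V : ℤ → Fin (M + 1) → K}

theorem sum_coord_shift_last (hV : (casorati V).det ≠ 0) (x : Fin (M + 1) → K) :
    ∑ j, x j * coord V (j + 1) (Fin.last M)
      = penultimate x + x (Fin.last M) * coord V (M + 1) (Fin.last M) := by
  have h : ∀ j : Fin (M + 1), x j * coord V (j + 1) (Fin.last M)
      = (if (j : ℕ) + 1 = M then x j else 0)
        + if j = Fin.last M then x j * coord V (M + 1) (Fin.last M) else 0 := fun j => by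
    rcases eq_or_ne j (Fin.last M) with rfl | hj
    · simp
    · have hj' : (j : ℕ) < M := Fin.val_lt_last hj
      have := coord_natCast hV (k := j + 1) (by omega) (Fin.last M)
      push_cast at this
      rw [this]
      simp [hj, eq_comm]
  rw [Finset.sum_congr rfl fun j _ => h j, Finset.sum_add_distrib, Finset.sum_ite_eq']
  simp [penultimate]

theorem sum_coord_shift_zero (hV : (casorati V).det ≠ 0) (x : Fin (M + 1) → K) :
    ∑ j, x j * coord V (j + 1) 0 = x (Fin.last M) * coord V (M + 1) 0 := by
  rw [Finset.sum_eq_single (Fin.last M)]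
  · simp
  · intro j _ hj
    have hj' : (j : ℕ) < M := Fin.val_lt_last hj
    have := coord_natCast hV (k := j + 1) (by omega) 0
    push_cast at this
    rw [this]
    simp
  · simp

theorem sum_coord_shift_two_zero (hV : (casorati V).det ≠ 0) (x : Fin (M + 1) → K) :
    ∑ j, x j * coord V (j + 2) 0
      = penultimate x * coord V (M + 1) 0 + x (Fin.last M) * coord V (M + 2) 0 := by
  have h : ∀ j : Fin (M + 1), x j * coord V (j + 2) 0
      = (if (j : ℕ) + 1 = M then x j else 0) * coord V (M + 1) 0
        + if j = Fin.last M then x j * coord V (M + 2) 0 else 0 := fun j => by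
    rcases eq_or_ne j (Fin.last M) with rfl | hj
    · simp
    · have hj' : (j : ℕ) < M := Fin.val_lt_last hj
      -- The index `j + 2` also leaves the basis at `j = M - 1`, where it equals `M + 1`; this is
      -- the `penultimate` term.
      by_cases hjM : (j : ℕ) + 1 = M
      · have : ((j : ℕ) : ℤ) + 2 = M + 1 := by omega
        simp [hj, hjM, this]
      · have := coord_natCast hV (k := j + 2) (by omega) 0
        push_cast at this
        rw [this]
        simp [hj, hjM]
  rw [Finset.sum_congr rfl fun j _ => h j, Finset.sum_add_distrib, Finset.sum_ite_eq',
    ← Finset.sum_mul]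
  simp [penultimate]

theorem sum_coord_shift_neg_last (hV : (casorati V).det ≠ 0) (x : Fin (M + 1) → K) :
    ∑ j, x j * coord V (j - 1) (Fin.last M) = x 0 * coord V (-1) (Fin.last M) := by
  rw [Finset.sum_eq_single 0]
  · simp
  · intro j _ hj
    have hj' : 0 < (j : ℕ) := Nat.pos_of_ne_zero fun h => hj (Fin.ext h)
    have := coord_natCast hV (k := j - 1) (by omega) (Fin.last M)
    rw [Nat.cast_sub hj', Nat.cast_one] at this
    rw [this, if_neg (by simp; omega), mul_zero]
  · simp

/-- The one algebraic identity behind both the Wronskian relation (`n = -1`) and the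
Schrödinger-type equation (`n = M + 1`). -/
theorem coord_recurrence_zero (hV : (casorati V).det ≠ 0) {c : K} {κ : Fin (M + 1) → K}
    (hrec : ∀ n i, V (n + 2) i + 2 * c * V (n + 1) i = κ i * V n i) (n : ℤ) :
    coord V (n + 2) 0 + 2 * c * coord V (n + 1) 0
      = penultimate (coord V n) * coord V (M + 1) 0 + coord V n (Fin.last M) *
        (coord V (M + 2) 0 + 2 * c * coord V (M + 1) 0) := by
  have h₁ := sum_coord_shift_zero hV (coord V n)
  have h₂ := sum_coord_shift_two_zero hV (coord V n)
  rw [coord_recurrence hV hrec n 0]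
  have : ∀ j : Fin (M + 1), coord V n j * (coord V (j + 2) 0 + 2 * c * coord V (j + 1) 0)
      = coord V n j * coord V (j + 2) 0 + 2 * c * (coord V n j * coord V (j + 1) 0) :=
    fun j => by ring
  rw [Finset.sum_congr rfl fun j _ => this j, Finset.sum_add_distrib, ← Finset.mul_sum, h₁, h₂]
  ring

/-- The columns `V_1, …, V_{M+1}` are a cyclic rotation, of sign `(-1)^M`, of `V_{M+1}, V_1, …,
V_M`, to which Cramer's rule applies. -/
theorem det_shift_one (hV : (casorati V).det ≠ 0) :
    (Matrix.of fun i j : Fin (M + 1) => V (1 + (j : ℤ)) i).det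
      = (-1) ^ M * ((casorati V).det * coord V (M + 1) 0) := by
  rw [← cramer_casorati hV]
  have : (Matrix.of fun i j : Fin (M + 1) => V (1 + (j : ℤ)) i)
      = ((casorati V).updateCol 0 (V (M + 1))).submatrix id (finRotate (M + 1)) := by
    ext i j
    rcases eq_or_ne j (Fin.last M) with rfl | hj
    · simp [add_comm]
    · have hj' : finRotate (M + 1) j ≠ 0 := fun h => by
        have := coe_finRotate_of_ne_last hj
        rw [h] at this
        simp at this
      rw [Matrix.submatrix_apply, Matrix.updateCol_ne hj', casorati, Matrix.of_apply,
        Matrix.of_apply, coe_finRotate_of_ne_last hj]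
      push_cast
      rw [add_comm]
      rfl
  rw [this, Matrix.det_permute', sign_finRotate]
  simp

theorem det_shift_neg_one (hV : (casorati V).det ≠ 0) :
    (Matrix.of fun i j : Fin (M + 1) => V (-1 + (j : ℤ)) i).det
      = (-1) ^ M * ((casorati V).det * coord V (-1) (Fin.last M)) := by
  rw [← cramer_casorati hV]
  have : (Matrix.of fun i j : Fin (M + 1) => V (-1 + (j : ℤ)) i)
      = ((casorati V).updateCol (Fin.last M) (V (-1))).submatrix id (finRotate (M + 1)).symm := by
    ext i j
    obtain ⟨j, rfl⟩ := (finRotate (M + 1)).surjective j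
    rw [Matrix.submatrix_apply, Equiv.symm_apply_apply]
    rcases eq_or_ne j (Fin.last M) with rfl | hj
    · simp
    · rw [Matrix.updateCol_ne hj, casorati, Matrix.of_apply, Matrix.of_apply,
        coe_finRotate_of_ne_last hj]
      push_cast
      congr 1
      ring
  rw [this, Matrix.det_permute', Equiv.Perm.sign_symm, sign_finRotate]
  simp

end

end Casorati

/-! ### Derivatives of the determinant and of the coordinates. -/

section CasoratiCalculus

variable {𝕜 : Type*} [RCLike 𝕜] {N M : ℕ}

theorem hasDerivAt_det {A : 𝕜 → Matrix (Fin N) (Fin N) 𝕜} {A' : Matrix (Fin N) (Fin N) 𝕜} {x : 𝕜}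
    (h : ∀ i j, HasDerivAt (fun t => A t i j) (A' i j) x) :
    HasDerivAt (fun t => (A t).det) (∑ j, ((A x).updateCol j fun i => A' i j).det) x := by
  simp only [Matrix.det_apply']
  rw [Finset.sum_comm]
  refine HasDerivAt.fun_sum fun τ _ => ?_
  rw [← Finset.mul_sum]
  refine HasDerivAt.const_mul _ ?_
  refine (HasDerivAt.fun_finsetProd fun i _ => h (τ i) i).congr_deriv ?_
  refine Finset.sum_congr rfl fun j _ => ?_
  rw [← Finset.mul_prod_erase _ _ (Finset.mem_univ j), Matrix.updateCol_self, smul_eq_mul,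
    mul_comm]
  refine congrArg _ (Finset.prod_congr rfl fun i hi => ?_)
  rw [Matrix.updateCol_ne (Finset.ne_of_mem_erase hi)]

theorem contDiff_det {E : Type*} [NormedAddCommGroup E] [NormedSpace 𝕜 E]
    {A : E → Matrix (Fin N) (Fin N) 𝕜} (h : ∀ i j, ContDiff 𝕜 ∞ fun t => A t i j) :
    ContDiff 𝕜 ∞ fun t => (A t).det := by
  simp only [Matrix.det_apply']
  exact ContDiff.sum fun τ _ => contDiff_const.mul (contDiff_prod fun i _ => h (τ i) i)

theorem contDiffOn_coord {E : Type*} [NormedAddCommGroup E] [NormedSpace 𝕜 E]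
    {V : E → ℤ → Fin N → 𝕜} (h : ∀ n i, ContDiff 𝕜 ∞ fun t => V t n i) (n : ℤ) (k : Fin N) :
    ContDiffOn 𝕜 ∞ (fun t => coord (V t) n k) {t | (casorati (V t)).det ≠ 0} := by
  simp only [coord_eq_div]
  refine ContDiffOn.div (contDiff_det fun i j => ?_).contDiffOn
    (contDiff_det fun i j => h j i).contDiffOn fun t ht => ht
  simp only [updateCol_casorati_apply]
  split_ifs
  exacts [h n i, h j i]

theorem differentiableAt_coord {V : 𝕜 → ℤ → Fin N → 𝕜} {V' : ℤ → Fin N → 𝕜} {x : 𝕜}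
    (h : ∀ n i, HasDerivAt (fun t => V t n i) (V' n i) x) (hV : (casorati (V x)).det ≠ 0)
    (n : ℤ) (k : Fin N) : DifferentiableAt 𝕜 (fun t => coord (V t) n k) x := by
  simp only [coord_eq_div]
  refine DifferentiableAt.fun_div
    (hasDerivAt_det (A' := Matrix.of fun i j => if j = k then V' n i else V' j i)
      fun i j => ?_).differentiableAt
    (hasDerivAt_det (A' := casorati V') fun i j => h j i).differentiableAt hV
  simp only [updateCol_casorati_apply, Matrix.of_apply]
  split_ifs
  exacts [h n i, h j i]

/-- The coordinates along a flow that shifts the index by `m`, up to a scalar factor. -/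
theorem hasDerivAt_coord {V : 𝕜 → ℤ → Fin N → 𝕜} {c x : 𝕜} {m : ℤ}
    (h : ∀ n i, HasDerivAt (fun t => V t n i) (V x (n + m) i + c * V x n i) x)
    (hV : (casorati (V x)).det ≠ 0) (n : ℤ) (k : Fin N) :
    HasDerivAt (fun t => coord (V t) n k)
      (coord (V x) (n + m) k - ∑ j : Fin N, coord (V x) n j * coord (V x) (j + m) k) x := by
  have hd : ∀ k, HasDerivAt (fun t => coord (V t) n k) (deriv (fun t => coord (V t) n k) x) x :=
    fun k => (differentiableAt_coord h hV n k).hasDerivAt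
  -- The expansion of `V n` is about to be differentiated, so it must hold in a neighbourhood of
  -- `x`.
  have hdet : ∀ᶠ t in nhds x, (casorati (V t)).det ≠ 0 :=
    (hasDerivAt_det (A' := casorati fun n i => V x (n + m) i + c * V x n i)
      fun i j => h j i).continuousAt.eventually_ne hV
  have hsum : ∑ j : Fin N, deriv (fun t => coord (V t) n j) x • V x j
      = V x (n + m) - ∑ j : Fin N, coord (V x) n j • V x (j + m) := by
    ext i
    have hl : HasDerivAt (fun t => ∑ j : Fin N, coord (V t) n j * V t j i) _ x :=
      HasDerivAt.fun_sum fun j _ => (hd j).mul (h j i)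
    have hr := (h n i).congr_of_eventuallyEq (hdet.mono fun t ht => by
      simpa only [Finset.sum_apply, Pi.smul_apply, smul_eq_mul] using
        congrFun (sum_coord_smul ht n) i)
    have e := hl.unique hr
    have hx := congrFun (sum_coord_smul hV n) i
    simp only [Finset.sum_apply, Pi.smul_apply, Pi.sub_apply, smul_eq_mul, mul_add,
      Finset.sum_add_distrib] at e hx ⊢
    -- The term `c V` scales all vectors alike and drops out of the coordinates.
    have hc : ∑ j : Fin N, coord (V x) n j * (c * V x j i) = c * V x n i := by
      rw [← hx, Finset.mul_sum]
      exact Finset.sum_congr rfl fun j _ => by ring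
    linear_combination e - hc
  have := inv_casorati_mulVec_sum hV fun j => deriv (fun t => coord (V t) n j) x
  rw [hsum, Matrix.mulVec_sub, Matrix.mulVec_sum] at this
  have hk := congrFun this k
  simp only [Pi.sub_apply, Finset.sum_apply, Matrix.mulVec_smul, Pi.smul_apply,
    smul_eq_mul] at hk
  exact (hd k).congr_deriv hk.symm

/-- Differentiating column `j` puts `V_{j+1} + c V_j` in its place: the first summand repeats a
column unless `j` is last, and the second contributes `c` times the determinant for each of the `M +
1` columns. -/
theorem hasDerivAt_det_casorati {V : 𝕜 → ℤ → Fin (M + 1) → 𝕜} {c x : 𝕜}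
    (h : ∀ n i, HasDerivAt (fun t => V t n i) (V x (n + 1) i + c * V x n i) x)
    (hV : (casorati (V x)).det ≠ 0) :
    HasDerivAt (fun t => (casorati (V t)).det)
      ((casorati (V x)).det * (coord (V x) (M + 1) (Fin.last M) + (M + 1) * c)) x := by
  refine (hasDerivAt_det (A := fun t => casorati (V t))
    (A' := casorati fun n i => V x (n + 1) i + c * V x n i) fun i j => h j i).congr_deriv ?_
  have hj : ∀ j : Fin (M + 1), ((casorati (V x)).updateCol j fun i =>
      casorati (fun n i => V x (n + 1) i + c * V x n i) i j).det
      = (casorati (V x)).det * ((if j = Fin.last M then coord (V x) (M + 1) (Fin.last M) else 0)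
        + c) := fun j => by
    have e : (fun i => casorati (fun n i => V x (n + 1) i + c * V x n i) i j)
        = V x (j + 1) + c • V x j := rfl
    rw [e, Matrix.det_updateCol_add, Matrix.det_updateCol_smul, cramer_casorati hV,
      cramer_casorati hV, coord_natCast hV j.2, if_pos rfl]
    rcases eq_or_ne j (Fin.last M) with rfl | hj
    · simp
      ring
    · have hj' : (j : ℕ) < M := Fin.val_lt_last hj
      have := coord_natCast hV (k := j + 1) (by omega) j
      push_cast at this
      rw [this]
      simp [hj]
      ring
  rw [Finset.sum_congr rfl fun j _ => hj j, ← Finset.mul_sum, Finset.sum_add_distrib,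
    Finset.sum_ite_eq']
  simp

/-! ### The Toda, Wronskian and Schrödinger-type relations. -/

section Relations

variable {v : 𝕜 → 𝕜 → ℤ → Fin (M + 1) → 𝕜} {c y s : 𝕜}

theorem hasDerivAt_coord_snd_zero
    (hs : ∀ n i y s, HasDerivAt (fun t => v y t n i) (v y s (n + 1) i + c * v y s n i) s)
    (h : (casorati (v y s)).det ≠ 0) (n : ℤ) :
    HasDerivAt (fun t => coord (v y t) n 0) (coord (v y s) (n + 1) 0
      - coord (v y s) n (Fin.last M) * coord (v y s) (M + 1) 0) s :=
  (hasDerivAt_coord (fun n i => hs n i y s) h n 0).congr_deriv (by rw [sum_coord_shift_zero h])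

theorem hasDerivAt_coord_snd_last
    (hs : ∀ n i y s, HasDerivAt (fun t => v y t n i) (v y s (n + 1) i + c * v y s n i) s)
    (h : (casorati (v y s)).det ≠ 0) (n : ℤ) :
    HasDerivAt (fun t => coord (v y t) n (Fin.last M)) (coord (v y s) (n + 1) (Fin.last M)
      - (penultimate (coord (v y s) n)
        + coord (v y s) n (Fin.last M) * coord (v y s) (M + 1) (Fin.last M))) s :=
  (hasDerivAt_coord (fun n i => hs n i y s) h n _).congr_deriv (by rw [sum_coord_shift_last h])

/-- The two-dimensional Toda equation. -/
theorem toda_coord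
    (hy : ∀ n i y s, HasDerivAt (fun t => v t s n i) (v y s (n - 1) i) y)
    (h : (casorati (v y s)).det ≠ 0) :
    D₁ (fun y s => coord (v y s) (M + 1) (Fin.last M)) y s
      = 1 - coord (v y s) (M + 1) 0 * coord (v y s) (-1) (Fin.last M) := by
  have hd := hasDerivAt_coord (V := fun t => v t s) (c := 0) (m := -1)
    (fun n i => by simpa [sub_eq_add_neg] using hy n i y s) h (M + 1) (Fin.last M)
  refine hd.deriv.trans ?_
  have hsum := sum_coord_shift_neg_last h (coord (v y s) (M + 1))
  simp only [sub_eq_add_neg] at hsum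
  have hM := coord_natCast h (Nat.lt_succ_self M) (Fin.last M)
  rw [Fin.val_last, if_pos rfl] at hM
  rw [hsum, add_neg_cancel_right, hM]

/-- In `w_s z - z_s w` the terms with `a` cancel; the rest is the recurrence at `n = -1`, whose
right-hand `2 c` is the coordinate `1` of `V_0` along itself. -/
theorem wronskian_coord {κ : Fin (M + 1) → 𝕜}
    (hs : ∀ n i y s, HasDerivAt (fun t => v y t n i) (v y s (n + 1) i + c * v y s n i) s)
    (hrec : ∀ n i y s, v y s (n + 2) i + 2 * c * v y s (n + 1) i = κ i * v y s n i)
    (h : (casorati (v y s)).det ≠ 0) :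
    D₂ (fun y s => coord (v y s) (M + 1) 0) y s * coord (v y s) (-1) (Fin.last M)
      - D₂ (fun y s => coord (v y s) (-1) (Fin.last M)) y s * coord (v y s) (M + 1) 0
      + 2 * c * (coord (v y s) (M + 1) 0 * coord (v y s) (-1) (Fin.last M)) = 2 * c := by
  have hw : D₂ (fun y s => coord (v y s) (M + 1) 0) y s = _ :=
    (hasDerivAt_coord_snd_zero hs h (M + 1)).deriv
  have hz : D₂ (fun y s => coord (v y s) (-1) (Fin.last M)) y s = _ :=
    (hasDerivAt_coord_snd_last hs h (-1)).deriv
  have hr := coord_recurrence_zero h (fun n i => hrec n i y s) (-1)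
  have h₀ : ∀ j : Fin (M + 1), coord (v y s) 0 j = if (j : ℕ) = 0 then 1 else 0 :=
    coord_natCast h (Nat.succ_pos M)
  -- Written so as to cover both cases: the two sides vanish for `M > 0` and equal `w` for `M = 0`,
  -- where `V_1 = V_{M+1}`.
  have h₁ : coord (v y s) 1 0 = coord (v y s) 0 (Fin.last M) * coord (v y s) (M + 1) 0 := by
    rw [← sum_coord_shift_zero h, Finset.sum_eq_single 0]
    · simp [h₀]
    · intro j _ hj
      simp [h₀, hj]
    · simp
  rw [show (-1 + 2 : ℤ) = 1 by norm_num, show (-1 + 1 : ℤ) = 0 by norm_num, h₁, h₀ 0] at hr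
  simp only [Fin.val_zero, if_true] at hr
  rw [hw, hz, show (M + 1 + 1 : ℤ) = M + 2 by ring, show (-1 + 1 : ℤ) = 0 by norm_num]
  linear_combination -hr

/-- Substituting the flow formulas for `w_s`, `w_ss` and `a_s` leaves exactly the recurrence at `n =
M + 1`. -/
theorem schrodinger_coord {κ : Fin (M + 1) → 𝕜}
    (hP : IsOpen {z : 𝕜 × 𝕜 | (casorati (v z.1 z.2)).det ≠ 0})
    (hs : ∀ n i y s, HasDerivAt (fun t => v y t n i) (v y s (n + 1) i + c * v y s n i) s)
    (hrec : ∀ n i y s, v y s (n + 2) i + 2 * c * v y s (n + 1) i = κ i * v y s n i)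
    (h : (casorati (v y s)).det ≠ 0) :
    D₂ (D₂ fun y s => coord (v y s) (M + 1) 0) y s
      + 2 * c * D₂ (fun y s => coord (v y s) (M + 1) 0) y s
      + 2 * D₂ (fun y s => coord (v y s) (M + 1) (Fin.last M)) y s * coord (v y s) (M + 1) 0
      = 0 := by
  have hw : ∀ y s, (casorati (v y s)).det ≠ 0 →
      D₂ (fun y s => coord (v y s) (M + 1) 0) y s = _ :=
    fun y s h => (hasDerivAt_coord_snd_zero hs h (M + 1)).deriv
  have ha : D₂ (fun y s => coord (v y s) (M + 1) (Fin.last M)) y s = _ :=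
    (hasDerivAt_coord_snd_last hs h (M + 1)).deriv
  have hww : D₂ (D₂ fun y s => coord (v y s) (M + 1) 0) y s = _ :=
    (D₂_congr hP hw h).trans ((hasDerivAt_coord_snd_zero hs h (M + 1 + 1)).sub
      ((hasDerivAt_coord_snd_last hs h (M + 1)).mul
        (hasDerivAt_coord_snd_zero hs h (M + 1)))).deriv
  have hr := coord_recurrence_zero h (fun n i => hrec n i y s) (M + 1)
  rw [hww, hw y s h, ha]
  rw [show (M + 1 + 2 : ℤ) = M + 3 by ring] at hr
  rw [show (M + 1 + 1 : ℤ) = M + 2 by ring] at hr ⊢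
  rw [show (M + 2 + 1 : ℤ) = M + 3 by ring]
  linear_combination hr

end Relations

end CasoratiCalculus

/-! ### The flows and the recurrence of `ψ`. -/

section Psi

variable {𝕜 : Type*} [RCLike 𝕜] {σ : ℝ} {p : 𝕜} (a₁ a₂ ξ₀ η₀ : 𝕜)

theorem contDiff_exp {E : Type*} [NormedAddCommGroup E] [NormedSpace 𝕜 E] {φ : E → 𝕜}
    (hφ : ContDiff 𝕜 ∞ φ) : ContDiff 𝕜 ∞ fun t => NormedSpace.exp (φ t) :=
  ContDiff.comp (g := (NormedSpace.exp : 𝕜 → 𝕜))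
    (contDiff_iff_contDiffAt.2 fun x => (NormedSpace.exp_analytic (𝕂 := 𝕜) x).contDiffAt) hφ

theorem contDiff_psi (σ : ℝ) (p : 𝕜) (n : ℤ) :
    ContDiff 𝕜 ∞ fun z : 𝕜 × 𝕜 => psi σ p a₁ a₂ ξ₀ η₀ n z.1 z.2 := by
  unfold psi phaseXi phaseEta
  exact (contDiff_const.mul (contDiff_exp (by fun_prop))).add
    (contDiff_const.mul (contDiff_exp (by fun_prop)))

theorem hasDerivAt_psi_fst (hp₁ : p⁻¹ ≠ ((√σ : ℝ) : 𝕜) / 2) (hp₂ : p⁻¹ ≠ -(((√σ : ℝ) : 𝕜) / 2))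
    (n : ℤ) (y s : 𝕜) :
    HasDerivAt (fun t => psi σ p a₁ a₂ ξ₀ η₀ n t s) (psi σ p a₁ a₂ ξ₀ η₀ (n - 1) y s) y := by
  have hlam : p⁻¹ - ((√σ : ℝ) : 𝕜) / 2 ≠ 0 := sub_ne_zero.2 hp₁
  have hmu : -p⁻¹ - ((√σ : ℝ) : 𝕜) / 2 ≠ 0 := fun h => hp₂ (by linear_combination -h)
  have hξ : HasDerivAt (fun t => phaseXi σ p ξ₀ t s) (p⁻¹ - ((√σ : ℝ) : 𝕜) / 2)⁻¹ y := by
    unfold phaseXi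
    exact ((((hasDerivAt_id y).const_mul _).add_const _).add_const _).congr_deriv (by simp)
  have hη : HasDerivAt (fun t => phaseEta σ p η₀ t s) (-p⁻¹ - ((√σ : ℝ) : 𝕜) / 2)⁻¹ y := by
    unfold phaseEta
    refine ((((hasDerivAt_id y).const_mul _).sub_const _).add_const _).congr_deriv ?_
    rw [mul_one, one_div, ← inv_neg]
    congr 1
    ring
  refine ((((hasDerivAt_exp (𝕂 := 𝕜)).comp y hξ).const_mul _).add
    (((hasDerivAt_exp (𝕂 := 𝕜)).comp y hη).const_mul _)).congr_deriv ?_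
  rw [psi, zpow_sub_one₀ hlam, zpow_sub_one₀ hmu]
  ring

theorem hasDerivAt_psi_snd (hp₁ : p⁻¹ ≠ ((√σ : ℝ) : 𝕜) / 2) (hp₂ : p⁻¹ ≠ -(((√σ : ℝ) : 𝕜) / 2))
    (n : ℤ) (y s : 𝕜) :
    HasDerivAt (fun t => psi σ p a₁ a₂ ξ₀ η₀ n y t)
      (psi σ p a₁ a₂ ξ₀ η₀ (n + 1) y s + ((√σ : ℝ) : 𝕜) / 2 * psi σ p a₁ a₂ ξ₀ η₀ n y s) s := by
  have hlam : p⁻¹ - ((√σ : ℝ) : 𝕜) / 2 ≠ 0 := sub_ne_zero.2 hp₁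
  have hmu : -p⁻¹ - ((√σ : ℝ) : 𝕜) / 2 ≠ 0 := fun h => hp₂ (by linear_combination -h)
  have hξ : HasDerivAt (fun t => phaseXi σ p ξ₀ y t) p⁻¹ s := by
    unfold phaseXi
    exact ((((hasDerivAt_id s).const_mul _).const_add _).add_const _).congr_deriv (by simp)
  have hη : HasDerivAt (fun t => phaseEta σ p η₀ y t) (-p⁻¹) s := by
    unfold phaseEta
    exact ((((hasDerivAt_id s).const_mul _).const_sub _).add_const _).congr_deriv (by simp)
  refine ((((hasDerivAt_exp (𝕂 := 𝕜)).comp s hξ).const_mul _).add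
    (((hasDerivAt_exp (𝕂 := 𝕜)).comp s hη).const_mul _)).congr_deriv ?_
  rw [psi, psi, zpow_add_one₀ hlam, zpow_add_one₀ hmu]
  ring

/-- Both bases `±p⁻¹ - c` are roots of `(x + c)² = p⁻²`, so the two exponentials obey one
recurrence. -/
theorem psi_recurrence (hp₁ : p⁻¹ ≠ ((√σ : ℝ) : 𝕜) / 2) (hp₂ : p⁻¹ ≠ -(((√σ : ℝ) : 𝕜) / 2))
    (n : ℤ) (y s : 𝕜) :
    psi σ p a₁ a₂ ξ₀ η₀ (n + 2) y s
      + 2 * (((√σ : ℝ) : 𝕜) / 2) * psi σ p a₁ a₂ ξ₀ η₀ (n + 1) y s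
      = (p⁻¹ ^ 2 - (((√σ : ℝ) : 𝕜) / 2) ^ 2) * psi σ p a₁ a₂ ξ₀ η₀ n y s := by
  have hlam : p⁻¹ - ((√σ : ℝ) : 𝕜) / 2 ≠ 0 := sub_ne_zero.2 hp₁
  have hmu : -p⁻¹ - ((√σ : ℝ) : 𝕜) / 2 ≠ 0 := fun h => hp₂ (by linear_combination -h)
  simp only [psi, zpow_add₀ hlam, zpow_add₀ hmu, zpow_ofNat]
  ring

end Psi

end TwoHS

/-! ### Assembly of the theorem. -/

open TwoHS in
theorem mainTheorem1 {𝕜 : Type*} [RCLike 𝕜] (N : ℕ) (σ : ℝ) (hσ : 0 < σ)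
    (p a₁ a₂ ξ₀ η₀ : Fin N → 𝕜) (hp : ∀ i, p i ≠ 0)
    (hp₁ : ∀ i, (p i)⁻¹ ≠ ((√σ : ℝ) : 𝕜) / 2) (hp₂ : ∀ i, (p i)⁻¹ ≠ -(((√σ : ℝ) : 𝕜) / 2))
    (f g h : 𝕜 → 𝕜 → 𝕜) (hg : g = tau σ p a₁ a₂ ξ₀ η₀ 0) (hf : f = tau σ p a₁ a₂ ξ₀ η₀ 1)
    (hh : h = tau σ p a₁ a₂ ξ₀ η₀ (-1)) :
    IsParametricSolutionOn (2 : 𝕜) (σ : 𝕜)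
      {z : 𝕜 × 𝕜 | f z.1 z.2 ≠ 0 ∧ g z.1 z.2 ≠ 0 ∧ h z.1 z.2 ≠ 0}
      (fun y s => y - lnDerivS g y s)
      (fun _ s => s)
      (fun y s => -D₂ (lnDerivS g) y s)
      (fun y s => g y s ^ 2 / (f y s * h y s)) := by
  have hσc : (σ : 𝕜) = 4 * (((√σ : ℝ) : 𝕜) / 2) ^ 2 := by
    have : ((√σ : ℝ) : 𝕜) ^ 2 = σ := by rw [← RCLike.ofReal_pow, Real.sq_sqrt hσ.le]
    rw [← this]
    ring
  set P : Set (𝕜 × 𝕜) := {z | f z.1 z.2 ≠ 0 ∧ g z.1 z.2 ≠ 0 ∧ h z.1 z.2 ≠ 0} with hPdef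
  have htau : ∀ n, ContDiff 𝕜 ∞ fun z : 𝕜 × 𝕜 => tau σ p a₁ a₂ ξ₀ η₀ n z.1 z.2 := fun n =>
    contDiff_det fun i j => contDiff_psi _ _ _ _ σ (p i) _
  have hP : IsOpen P := by
    have hne : ∀ n, IsOpen {z : 𝕜 × 𝕜 | tau σ p a₁ a₂ ξ₀ η₀ n z.1 z.2 ≠ 0} := fun n =>
      isOpen_ne_fun (htau n).continuous continuous_const
    rw [hPdef, hf, hg, hh]
    exact (hne 1).inter ((hne 0).inter (hne (-1)))
  obtain _ | M := N
  -- For `N = 0` there is no last column; all `τ` are empty determinants equal to `1`, and the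
  -- solution is `x = y`, `u = 0`, `ρ = 1`.
  · have htau1 : ∀ n, tau σ p a₁ a₂ ξ₀ η₀ n = fun _ _ => 1 := fun n => by
      funext y s
      exact Matrix.det_isEmpty
    have hln : lnDerivS (fun _ _ => 1 : 𝕜 → 𝕜 → 𝕜) = fun _ _ => 0 := by
      funext y s
      simp [lnDerivS, logDeriv_apply]
    rw [htau1] at hf hg hh
    have hD₁ : ∀ b : 𝕜, D₁ (fun _ _ => b) = fun _ _ => (0 : 𝕜) := fun b => by
      funext y s
      exact deriv_const y b
    have hD₂ : ∀ b : 𝕜, D₂ (fun _ _ => b) = fun _ _ => (0 : 𝕜) := fun b => by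
      funext y s
      exact deriv_const s b
    refine isParametricSolutionOn_of_bilinear (k := 0) (a := fun _ _ => 0) (w := fun _ _ => 1)
      (z := fun _ _ => 1) hσc hP contDiffOn_const contDiffOn_const contDiffOn_const
      ?_ ?_ ?_ ?_ ?_ ?_ ?_ ?_ <;> intro y s _ <;> simp [hf, hg, hh, hln, hD₁, hD₂]
  · set v : 𝕜 → 𝕜 → ℤ → Fin (M + 1) → 𝕜 := fun y s n i =>
      psi σ (p i) (a₁ i) (a₂ i) (ξ₀ i) (η₀ i) n y s with hv
    set c : 𝕜 := ((√σ : ℝ) : 𝕜) / 2 with hc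
    have hsmooth : ∀ n i, ContDiff 𝕜 ∞ fun z : 𝕜 × 𝕜 => v z.1 z.2 n i :=
      fun n i => contDiff_psi _ _ _ _ σ (p i) n
    have hy : ∀ n i y s, HasDerivAt (fun t => v t s n i) (v y s (n - 1) i) y :=
      fun n i y s => hasDerivAt_psi_fst _ _ _ _ (hp₁ i) (hp₂ i) n y s
    have hs : ∀ n i y s, HasDerivAt (fun t => v y t n i) (v y s (n + 1) i + c * v y s n i) s :=
      fun n i y s => hasDerivAt_psi_snd _ _ _ _ (hp₁ i) (hp₂ i) n y s
    have hrec : ∀ n i y s, v y s (n + 2) i + 2 * c * v y s (n + 1) i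
        = ((p i)⁻¹ ^ 2 - c ^ 2) * v y s n i :=
      fun n i y s => psi_recurrence _ _ _ _ (hp₁ i) (hp₂ i) n y s
    have hgdet : g = fun y s => (casorati (v y s)).det := by
      funext y s
      rw [hg]
      simp only [tau, zero_add]
      rfl
    have hdetP : ∀ y s, (y, s) ∈ P → (casorati (v y s)).det ≠ 0 := fun y s hz => by
      have := hz.2.1
      rwa [hgdet] at this
    have hopen : IsOpen {z : 𝕜 × 𝕜 | (casorati (v z.1 z.2)).det ≠ 0} :=
      isOpen_ne_fun (contDiff_det fun i j => hsmooth j i).continuous continuous_const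
    have hfw : ∀ y s, (y, s) ∈ P → f y s = (-1) ^ M * (g y s * coord (v y s) (M + 1) 0) :=
      fun y s hz => by
        rw [hf, hgdet]
        exact det_shift_one (hdetP y s hz)
    have hhz : ∀ y s, (y, s) ∈ P → h y s = (-1) ^ M * (g y s * coord (v y s) (-1) (Fin.last M)) :=
      fun y s hz => by
        rw [hh, hgdet]
        exact det_shift_neg_one (hdetP y s hz)
    have hln : ∀ y s, (y, s) ∈ P →
        lnDerivS g y s = coord (v y s) (M + 1) (Fin.last M) + (M + 1) * c := fun y s hz => by
      have hd := hdetP y s hz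
      rw [lnDerivS, logDeriv_apply, hgdet, (hasDerivAt_det_casorati (V := fun t => v y t)
        (fun n i => hs n i y s) hd).deriv, mul_div_cancel_left₀ _ hd]
    have hcoord : ∀ n k, SmoothOn (fun y s => coord (v y s) n k) P := fun n k =>
      (contDiffOn_coord (V := fun z : 𝕜 × 𝕜 => v z.1 z.2) hsmooth n k).mono
        fun z hz => hdetP _ _ hz
    refine isParametricSolutionOn_of_bilinear (k := (M + 1) * c) hσc hP
      (hcoord (M + 1) (Fin.last M)) (hcoord (M + 1) 0) (hcoord (-1) (Fin.last M))
      ?_ ?_ ?_ ?_ ?_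
      (fun y s hz => toda_coord hy (hdetP y s hz))
      (fun y s hz => wronskian_coord hs hrec (hdetP y s hz))
      (fun y s hz => schrodinger_coord hopen hs hrec (hdetP y s hz))
    · intro y s hz h0
      exact hz.1 (by rw [hfw y s hz, h0]; simp)
    · intro y s hz h0
      exact hz.2.2 (by rw [hhz y s hz, h0]; simp)
    · intro y s hz
      rw [hln y s hz]
    · intro y s hz
      rw [D₂_congr hP hln hz]
      exact congrArg _ (((hcoord _ _).hasDerivAt_snd hP hz).add_const _).deriv
    · intro y s hz
      -- The rotation signs of `f` and `h` cancel in the product.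
      have hsq : ((-1 : 𝕜) ^ M) * (-1) ^ M = 1 := by rw [← mul_pow]; simp
      have hg0 : g y s ≠ 0 := hz.2.1
      have e : f y s * h y s = g y s ^ 2
          * (coord (v y s) (M + 1) 0 * coord (v y s) (-1) (Fin.last M)) := by
        rw [hfw y s hz, hhz y s hz]
        linear_combination (g y s ^ 2
          * (coord (v y s) (M + 1) 0 * coord (v y s) (-1) (Fin.last M))) * hsq
      rw [e, div_mul_cancel_left₀ (pow_ne_zero 2 hg0)]
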